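/- For integers $0\le r\le n$ and $k\ge 0$, let $N_k^{n,r}$ be the number of ordered pairs of lattice walks on an $r\times(n-r)$ rectangle, each proceeding by unit steps E (East) or N (North) from the SW corner $(0,0)$ to the NE corner $(r,n-r)$, such that the vertex sets of the two walks have exactly $k$ points in common, not counting the initial and the terminal vertex. In the ring $\mathbb{Q}[[y,z]]$ of formal power series, let $$f=\frac{(1-y-z)-\sqrt{(1-y-z)^2-4yz}}{2},$$ where the square root is the unique power series with constant term $1$ whose square is $(1-y-z)^2-4yz$. Then $f$ satisfies $f=(y+f)(z+f)$, and it is the only power series with constant term $0$ that does so. For all integers $n\ge 1$, $0\le r\le n$ and $k\ge 0$, $$N_k^{n,r}=[y^r z^{n-r}]\,(y+z+2f)^{k+1}.$$ Moreover, for all integers $n, r, k$ with $0\le r\le n$ and $0\le k\le n-2$, $$N_k^{n,r}=\frac{2(k+1)}{n-k-1}\sum_{i=0}^{k}\binom{k}{i}\binom{n-k+i-1}{r}\binom{n-i-1}{n-r}.\qquad(1\mathrm{a})$$ -/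

import Mathlib

/-- A unit step of a lattice walk: East or North. -/
inductive LatticeStep : Type
  | E : LatticeStep
  | N : LatticeStep
  deriving DecidableEq

/-- The lattice point reached from the origin by the given list of steps. -/
def latticeEndpoint (w : List LatticeStep) : ℕ × ℕ :=
  (w.count LatticeStep.E, w.count LatticeStep.N)

/-- The walks with E and N steps from the SW corner `(0, 0)` to the NE corner `(a, b)`
of the `a × b` lattice rectangle. -/
abbrev LatticeWalk (a b : ℕ) : Type :=
  {w : List LatticeStep // latticeEndpoint w = (a, b)}

/-- The set of all lattice points visited by a walk that starts at the origin. -/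
def walkVertices (w : List LatticeStep) : Finset (ℕ × ℕ) :=
  (Finset.range (w.length + 1)).image fun i => latticeEndpoint (w.take i)

/-- The number of points in the intersection of two walks on the `a × b` rectangle: the common
vertices, excluding the initial and the terminal vertex. -/
def numMeetings {a b : ℕ} (P Q : LatticeWalk a b) : ℕ :=
  ((walkVertices P.1 ∩ walkVertices Q.1) \ {(0, 0), (a, b)}).card

theorem latticeWalk_length {a b : ℕ} (P : LatticeWalk a b) : P.1.length = a + b := by
  have key : ∀ w : List LatticeStep,
      w.length = w.count LatticeStep.E + w.count LatticeStep.N := by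
    intro w
    induction w with
    | nil => rfl
    | cons s w ih => cases s <;> simp [ih] <;> omega
  have h := P.2
  simp only [latticeEndpoint, Prod.mk.injEq] at h
  rw [key, h.1, h.2]

instance latticeStepFinite : Finite LatticeStep :=
  Finite.of_surjective (fun b : Bool => if b then LatticeStep.E else LatticeStep.N)
    (fun s => by cases s; exacts [⟨true, rfl⟩, ⟨false, rfl⟩])

/-- There are finitely many walks, so that the cardinality below is a genuine count. -/
instance latticeWalkFinite (a b : ℕ) : Finite (LatticeWalk a b) := by
  have h : {w : List LatticeStep | w.length = a + b}.Finite := List.finite_length_eq _ _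
  have h' : {w : List LatticeStep | latticeEndpoint w = (a, b)}.Finite :=
    h.subset fun w hw => latticeWalk_length (a := a) (b := b) ⟨w, hw⟩
  exact h'.to_subtype

/-- The number of ordered pairs of walks on an `r × (n - r)` rectangle (`r ≤ n`) that intersect
in exactly `k` points. -/
noncomputable def pairCount (n r k : ℕ) : ℕ :=
  Nat.card {PQ : LatticeWalk r (n - r) × LatticeWalk r (n - r) // numMeetings PQ.1 PQ.2 = k}

/-- The ring of formal power series in two variables over `ℚ`. -/
abbrev Series2 : Type := MvPowerSeries (Fin 2) ℚ

/-- The first variable. -/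
noncomputable def yVar : Series2 := MvPowerSeries.X 0

/-- The second variable. -/
noncomputable def zVar : Series2 := MvPowerSeries.X 1

/-- The coefficient of `y ^ a * z ^ b`. -/
noncomputable def coeffYZ (a b : ℕ) (F : Series2) : ℚ :=
  MvPowerSeries.coeff (Finsupp.single 0 a + Finsupp.single 1 b) F

/-- `s` is the formal square root `√D` of a power series `D` with constant term `1`:
the square root with constant term `1`. -/
def IsFormalSqrt (s D : Series2) : Prop :=
  s ^ 2 = D ∧ MvPowerSeries.constantCoeff s = 1

/-! Everything is expressed through the series `w` with w = 1 + (y+z)w + yzw², and f = yzw. Track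
the horizontal distance d between the two walks at equal times. It makes steps 0 (weight y+z), +1
(weight y) and -1 (weight z), so `w` counts distance paths that stay weakly on one side of their
starting level and return to it. Between consecutive meetings the walks share a step or make an
excursion on one of two sides, giving y + z + 2yzw; k inner meetings cut a pair into k+1 such
pieces. `meetPoly_succ` and `meetSeries_eq` turn this into a common recursion. For the explicit
formula, put α = 1 + zw and β = 1 + yw. Then αβ = w and y + z + 2f = yα + zβ. The coefficients of
α^p β^q are known in closed form (`coeffYZ_pow_mul_pow`), and the binomial theorem finishes. -/

theorem exists_narayana_series :
    ∃ w : Series2, w = 1 + (yVar + zVar) * w + yVar * zVar * w ^ 2 := by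
  set v : Series2 := (1 - yVar - zVar)⁻¹ with hv
  have hv1 : (1 - yVar - zVar) * v = 1 :=
    MvPowerSeries.mul_inv_cancel _ (by simp [yVar, zVar])
  set t : Series2 := yVar * zVar * v ^ 2 with ht
  have hs : PowerSeries.HasSubst t :=
    PowerSeries.HasSubst.of_constantCoeff_zero (by simp [ht, yVar])
  set φ := PowerSeries.substAlgHom (R := ℚ) hs
  -- Dividing the quadratic by 1 - y - z and writing w = vc turns it into the Catalan equation c = 1
  -- + tc².
  set c : Series2 := φ (PowerSeries.catalanSeries.map (Nat.castRingHom ℚ)) with hc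
  have hcat : c ^ 2 * t + 1 = c := by
    have h := congrArg (fun x => φ (PowerSeries.map (Nat.castRingHom ℚ) x))
      PowerSeries.catalanSeries_sq_mul_X_add_one
    simp only [map_add, map_mul, map_pow, PowerSeries.map_X, map_one] at h
    rwa [PowerSeries.substAlgHom_X hs] at h
  refine ⟨v * c, ?_⟩
  rw [ht] at hcat
  linear_combination c * hv1 - hcat

/-! ### Coefficient extraction -/

theorem coeffYZ_add (a b : ℕ) (F G : Series2) :
    coeffYZ a b (F + G) = coeffYZ a b F + coeffYZ a b G := map_add _ _ _

theorem coeffYZ_zero (a b : ℕ) : coeffYZ a b 0 = 0 := map_zero _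

theorem coeffYZ_sum {ι : Type*} (a b : ℕ) (s : Finset ι) (F : ι → Series2) :
    coeffYZ a b (∑ i ∈ s, F i) = ∑ i ∈ s, coeffYZ a b (F i) := map_sum _ _ _

theorem coeffYZ_natCast_mul (a b m : ℕ) (F : Series2) :
    coeffYZ a b ((m : Series2) * F) = m * coeffYZ a b F := by
  rw [← nsmul_eq_mul, ← nsmul_eq_mul]
  exact map_nsmul _ _ _

theorem single_add_single_le_iff {p q a b : ℕ} :
    (Finsupp.single 0 p + Finsupp.single 1 q : Fin 2 →₀ ℕ) ≤
      Finsupp.single 0 a + Finsupp.single 1 b ↔ p ≤ a ∧ q ≤ b := by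
  constructor
  · intro h
    have h0 := h 0
    have h1 := h 1
    simp at h0 h1
    exact ⟨h0, h1⟩
  · rintro ⟨h0, h1⟩ i
    fin_cases i <;> simpa

theorem single_add_single_inj {p q a b : ℕ} :
    (Finsupp.single 0 p + Finsupp.single 1 q : Fin 2 →₀ ℕ) =
      Finsupp.single 0 a + Finsupp.single 1 b ↔ p = a ∧ q = b := by
  rw [le_antisymm_iff, single_add_single_le_iff, single_add_single_le_iff]
  omega

theorem yVar_pow_mul_zVar_pow (p q : ℕ) :
    yVar ^ p * zVar ^ q =
      MvPowerSeries.monomial (Finsupp.single 0 p + Finsupp.single 1 q : Fin 2 →₀ ℕ) (1 : ℚ) := by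
  rw [yVar, zVar, MvPowerSeries.X_pow_eq, MvPowerSeries.X_pow_eq,
    MvPowerSeries.monomial_mul_monomial, one_mul]

theorem coeffYZ_monomial (a b p q : ℕ) :
    coeffYZ a b (yVar ^ p * zVar ^ q) = if p = a ∧ q = b then 1 else 0 := by
  rw [yVar_pow_mul_zVar_pow, coeffYZ, MvPowerSeries.coeff_monomial]
  simp only [single_add_single_inj, eq_comm]

theorem coeffYZ_monomial_mul (a b p q : ℕ) (F : Series2) :
    coeffYZ a b (yVar ^ p * zVar ^ q * F) =
      if p ≤ a ∧ q ≤ b then coeffYZ (a - p) (b - q) F else 0 := by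
  rw [yVar_pow_mul_zVar_pow, coeffYZ, MvPowerSeries.coeff_monomial_mul]
  simp only [single_add_single_le_iff, one_mul]
  split_ifs with h
  · rw [coeffYZ]
    congr 2
    ext i
    fin_cases i <;> simp
  · rfl

theorem coeffYZ_yVar_mul (a b : ℕ) (F : Series2) :
    coeffYZ a b (yVar * F) = if 1 ≤ a then coeffYZ (a - 1) b F else 0 := by
  simpa using coeffYZ_monomial_mul a b 1 0 F

theorem coeffYZ_zVar_mul (a b : ℕ) (F : Series2) :
    coeffYZ a b (zVar * F) = if 1 ≤ b then coeffYZ a (b - 1) F else 0 := by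
  simpa using coeffYZ_monomial_mul a b 0 1 F

theorem coeffYZ_one (a b : ℕ) : coeffYZ a b 1 = if a = 0 ∧ b = 0 then 1 else 0 := by
  simpa [eq_comm] using coeffYZ_monomial a b 0 0

/-! ### Coefficients of α^p β^q and the explicit formula -/

/-- The coefficient of `y ^ i * z ^ j` in `α ^ p * β ^ q`, where `α = 1 + z α β` and
`β = 1 + y α β`. -/
def ballotCoeff (p q : ℕ) : ℕ → ℕ → ℚ
  | i + 1, j + 1 =>
    (q + j + 1).multichoose (i + 1) * (p + i + 1).multichoose (j + 1) -
      (q + j + 2).multichoose i * (p + i + 2).multichoose j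
  | i + 1, 0 => q.multichoose (i + 1)
  | 0, j => p.multichoose j

theorem ballotCoeff_swap (p q i j : ℕ) : ballotCoeff p q i j = ballotCoeff q p j i := by
  cases i <;> cases j <;> simp [ballotCoeff, mul_comm]

theorem ballotCoeff_succ_left_zero (p q i : ℕ) :
    ballotCoeff (p + 1) q i 0 = ballotCoeff p q i 0 := by
  cases i <;> simp [ballotCoeff]

/-- Pascal's rule applied inside the determinant; it mirrors α^(p+1) β^q = α^p β^q + z α^(p+1)
β^(q+1). -/
theorem ballotCoeff_succ_left (p q i j : ℕ) :
    ballotCoeff (p + 1) q i (j + 1) =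
      ballotCoeff p q i (j + 1) + ballotCoeff (p + 1) (q + 1) i j := by
  cases i with
  | zero => simp [ballotCoeff, Nat.multichoose_succ_succ]
  | succ i =>
    have e1 : (p + 1 + i + 1).multichoose (j + 1) =
        (p + i + 1).multichoose (j + 1) + (p + i + 2).multichoose j := by
      rw [show p + 1 + i + 1 = (p + i + 1) + 1 by ring, Nat.multichoose_succ_succ]
    cases j with
    | zero => simp [ballotCoeff, e1]; ring
    | succ j =>
      have e2 : (p + 1 + i + 2).multichoose (j + 1) =
          (p + i + 2).multichoose (j + 1) + (p + i + 3).multichoose j := by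
        rw [show p + 1 + i + 2 = (p + i + 2) + 1 by ring, Nat.multichoose_succ_succ]
      simp only [ballotCoeff, e1, e2]
      rw [show p + 1 + i + 1 = p + i + 2 by ring, show p + 1 + i + 2 = p + i + 3 by ring,
        show q + 1 + j + 1 = q + (j + 1) + 1 by ring, show q + 1 + j + 2 = q + (j + 1) + 2 by ring]
      push_cast
      ring

/-- Absorption identities trade the determinant for two products of binomials, the form that can be
summed over p + q = k + 1. -/
theorem ballotCoeff_mul (p q i j : ℕ) (hij : 0 < i + j) :
    ((i : ℚ) + j) * ballotCoeff p q i j =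
      p * (p + i + j - 1).choose (p + i) * (q + i + j).choose (q + j) +
        q * (q + i + j - 1).choose (q + j) * (p + i + j).choose (p + i) := by
  have edge : ∀ p j : ℕ, ((j : ℚ) + 1) * p.multichoose (j + 1) = p * (p + j).choose p := by
    intro p j
    cases p with
    | zero => simp
    | succ p =>
      rw [Nat.multichoose_eq, show p + 1 + (j + 1) - 1 = p + 1 + j by omega,
        show (p + 1 + j).choose (p + 1) = (p + 1 + j).choose j by
          rw [Nat.choose_symm_add]]
      have := Nat.choose_succ_right_eq (p + 1 + j) j
      rw [show p + 1 + j - j = p + 1 by omega] at this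
      have h2 := congrArg (Nat.cast (R := ℚ)) this
      push_cast at h2 ⊢
      linarith
  cases i with
  | zero =>
    obtain ⟨j, rfl⟩ := Nat.exists_eq_add_of_lt (show 0 < j by omega)
    simp [ballotCoeff, Nat.choose_eq_zero_of_lt]
    simpa using edge p j
  | succ i =>
    cases j with
    | zero =>
      simp [ballotCoeff, Nat.choose_eq_zero_of_lt]
      simpa using edge q i
    | succ j =>
      simp only [ballotCoeff, Nat.multichoose_eq]
      have hX := Nat.choose_succ_right_eq (q + i + j + 1) i
      have hY := Nat.choose_succ_right_eq (p + i + j + 1) j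
      rw [show q + i + j + 1 - i = q + j + 1 by omega] at hX
      rw [show p + i + j + 1 - j = p + i + 1 by omega] at hY
      have c1 : (p + (i + 1) + (j + 1) - 1).choose (p + (i + 1)) = (p + i + j + 1).choose j := by
        rw [show p + (i + 1) + (j + 1) - 1 = p + (i + 1) + j by omega, Nat.choose_symm_add]
        congr 1; omega
      have c2 : (q + (i + 1) + (j + 1) - 1).choose (q + (j + 1)) = (q + i + j + 1).choose i := by
        rw [show q + (i + 1) + (j + 1) - 1 = q + (j + 1) + i by omega, Nat.choose_symm_add]
        congr 1; omega
      have c3 : (q + (i + 1) + (j + 1)).choose (q + (j + 1)) =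
          (q + i + j + 1).choose i + (q + i + j + 1).choose (i + 1) := by
        rw [show q + (i + 1) + (j + 1) = q + (j + 1) + (i + 1) by omega, Nat.choose_symm_add,
          ← Nat.choose_succ_succ]
        congr 1; omega
      have c4 : (p + (i + 1) + (j + 1)).choose (p + (i + 1)) =
          (p + i + j + 1).choose j + (p + i + j + 1).choose (j + 1) := by
        rw [Nat.choose_symm_add, ← Nat.choose_succ_succ]
        congr 1; omega
      rw [c1, c2, c3, c4, show q + j + 1 + (i + 1) - 1 = q + i + j + 1 by omega,
        show p + i + 1 + (j + 1) - 1 = p + i + j + 1 by omega,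
        show q + j + 2 + i - 1 = q + i + j + 1 by omega,
        show p + i + 2 + j - 1 = p + i + j + 1 by omega]
      generalize (q + i + j + 1).choose i = X0 at *
      generalize (q + i + j + 1).choose (i + 1) = X1 at *
      generalize (p + i + j + 1).choose j = Y0 at *
      generalize (p + i + j + 1).choose (j + 1) = Y1 at *
      have hX' := congrArg (Nat.cast (R := ℚ)) hX
      have hY' := congrArg (Nat.cast (R := ℚ)) hY
      push_cast at hX' hY' ⊢
      linear_combination (Y1 + Y0 : ℚ) * hX' + (X1 + X0 : ℚ) * hY'

/-- The defining equations lower either an exponent or the degree, hence an outer induction on i + j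
and inner ones on q and p. -/
theorem coeffYZ_pow_mul_pow {α β : Series2} (hα : α = 1 + zVar * (α * β))
    (hβ : β = 1 + yVar * (α * β)) (p q i j : ℕ) :
    coeffYZ i j (α ^ p * β ^ q) = ballotCoeff p q i j := by
  have rα : ∀ p q, α ^ (p + 1) * β ^ q = α ^ p * β ^ q + zVar * (α ^ (p + 1) * β ^ (q + 1)) := by
    intro p q
    linear_combination α ^ p * β ^ q * hα
  have rβ : ∀ p q, α ^ p * β ^ (q + 1) = α ^ p * β ^ q + yVar * (α ^ (p + 1) * β ^ (q + 1)) := by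
    intro p q
    linear_combination α ^ p * β ^ q * hβ
  induction hm : i + j using Nat.strong_induction_on generalizing p q i j with
  | _ m ih =>
  have left : ∀ p q, coeffYZ i j (α ^ p * β ^ q) = ballotCoeff p q i j →
      coeffYZ i j (α ^ (p + 1) * β ^ q) = ballotCoeff (p + 1) q i j := by
    intro p q h
    rw [rα, coeffYZ_add, coeffYZ_zVar_mul, h]
    cases j with
    | zero => simp [ballotCoeff_succ_left_zero]
    | succ j => simp [ballotCoeff_succ_left, ih (i + j) (by omega) (p + 1) (q + 1) i j rfl]
  have right : ∀ p q, coeffYZ i j (α ^ p * β ^ q) = ballotCoeff p q i j →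
      coeffYZ i j (α ^ p * β ^ (q + 1)) = ballotCoeff p (q + 1) i j := by
    intro p q h
    rw [rβ, coeffYZ_add, coeffYZ_yVar_mul, h, ballotCoeff_swap p, ballotCoeff_swap p]
    cases i with
    | zero => simp [ballotCoeff_succ_left_zero]
    | succ i =>
      simp [ballotCoeff_succ_left, ih (i + j) (by omega) (p + 1) (q + 1) i j rfl,
        ballotCoeff_swap (p + 1)]
  induction q with
  | succ q hq => exact right p q hq
  | zero =>
    induction p with
    | succ p hp => exact left p 0 hp
    | zero =>
      rw [pow_zero, pow_zero, one_mul, coeffYZ_one]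
      split_ifs with h
      · obtain ⟨rfl, rfl⟩ := h
        simp [ballotCoeff]
      · have hpos : 0 < i + j := by omega
        -- With p = q = 0 the right side vanishes, so the closed form agrees with the series 1 in
        -- positive degree.
        have h0 := ballotCoeff_mul 0 0 i j hpos
        have hne : (i : ℚ) + j ≠ 0 := by exact_mod_cast hpos.ne'
        simpa [hne, eq_comm] using h0

theorem coeffYZ_add_pow {α β : Series2} (hα : α = 1 + zVar * (α * β))
    (hβ : β = 1 + yVar * (α * β)) {n r k : ℕ} (hr : r ≤ n) (hk : k + 2 ≤ n) :
    coeffYZ r (n - r) ((yVar * α + zVar * β) ^ (k + 1)) =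
      2 * ((k : ℚ) + 1) / ((n : ℚ) - (k : ℚ) - 1) *
        ∑ i ∈ Finset.range (k + 1),
          (Nat.choose k i : ℚ) * (Nat.choose (n - k + i - 1) r : ℚ) *
            (Nat.choose (n - i - 1) (n - r) : ℚ) := by
  have hn : ((n : ℚ) - k - 1) ≠ 0 := by
    have : (k : ℚ) + 2 ≤ n := by exact_mod_cast hk
    intro h
    linarith
  have term : ∀ p q : ℕ, p + q = k + 1 →
      ((n : ℚ) - k - 1) * coeffYZ r (n - r) ((yVar * α) ^ p * (zVar * β) ^ q) =
        p * (n - q - 1).choose r * (n - p).choose (n - r) +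
          q * (n - p - 1).choose (n - r) * (n - q).choose r := by
    intro p q hpq
    rw [show (yVar * α) ^ p * (zVar * β) ^ q = yVar ^ p * zVar ^ q * (α ^ p * β ^ q) by ring,
      coeffYZ_monomial_mul, coeffYZ_pow_mul_pow hα hβ]
    split_ifs with h
    · obtain ⟨i, rfl⟩ := Nat.exists_eq_add_of_le h.1
      obtain ⟨j, hj⟩ := Nat.exists_eq_add_of_le h.2
      obtain rfl : n = p + i + (q + j) := by omega
      have := ballotCoeff_mul p q i j (by omega)
      rw [hj, show p + i - p = i by omega, show q + j - q = j by omega,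
        show p + i + (q + j) - q - 1 = p + i + j - 1 by omega,
        show p + i + (q + j) - p - 1 = q + i + j - 1 by omega,
        show p + i + (q + j) - q = p + i + j by omega,
        show p + i + (q + j) - p = q + i + j by omega, ← this]
      have hpq' : (p : ℚ) + q = k + 1 := by exact_mod_cast hpq
      push_cast
      linear_combination ballotCoeff p q i j * hpq'
    -- Outside the support the binomials vanish as well, so all p can be summed uniformly.
    · rw [not_and_or] at h
      rcases h with h | h
      · rw [Nat.choose_eq_zero_of_lt (show n - p < n - r by omega),
          Nat.choose_eq_zero_of_lt (show n - p - 1 < n - r by omega)]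
        simp
      · rw [Nat.choose_eq_zero_of_lt (show n - q < r by omega),
          Nat.choose_eq_zero_of_lt (show n - q - 1 < r by omega)]
        simp
  set T : ℕ → ℚ := fun i => (Nat.choose k i : ℚ) * (Nat.choose (n - k + i - 1) r : ℚ) *
            (Nat.choose (n - i - 1) (n - r) : ℚ) with hT
  have key : ((n : ℚ) - k - 1) * coeffYZ r (n - r) ((yVar * α + zVar * β) ^ (k + 1)) =
      2 * ((k : ℚ) + 1) * ∑ i ∈ Finset.range (k + 1), T i := by
    rw [add_pow, coeffYZ_sum, Finset.mul_sum]
    have split : ∀ p ∈ Finset.range (k + 1 + 1),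
        ((n : ℚ) - k - 1) * coeffYZ r (n - r)
          ((yVar * α) ^ p * (zVar * β) ^ (k + 1 - p) * ((k + 1).choose p : Series2)) =
        (((k + 1).choose p * p : ℕ) : ℚ) *
            ((n - (k + 1 - p) - 1).choose r * (n - p).choose (n - r)) +
          (((k + 1).choose p * (k + 1 - p) : ℕ) : ℚ) *
            ((n - p - 1).choose (n - r) * (n - (k + 1 - p)).choose r) := by
      intro p hp
      have hp' : p + (k + 1 - p) = k + 1 := by
        have := Finset.mem_range.1 hp
        omega
      rw [mul_comm _ (Nat.cast _), coeffYZ_natCast_mul]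
      have := term p _ hp'
      rw [Nat.cast_mul, Nat.cast_mul]
      linear_combination ((k + 1).choose p : ℚ) * this
    -- The terms p = 0 and p = k + 1 have weight zero in the first and second sum. By absorption
    -- both sums then become (k+1) ∑ T i, whence the factor 2.
    rw [Finset.sum_congr rfl split, Finset.sum_add_distrib, Finset.sum_range_succ',
      Finset.sum_range_succ _ (k + 1)]
    simp only [Nat.sub_self, Nat.mul_zero, Nat.cast_zero, zero_mul, add_zero]
    rw [two_mul, add_mul, Finset.mul_sum]
    congr 1
    · refine Finset.sum_congr rfl fun i hi => ?_
      have hi' := Finset.mem_range.1 hi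
      rw [← Nat.add_one_mul_choose_eq k i, show n - (k + 1 - (i + 1)) - 1 = n - k + i - 1 by omega,
        show n - (i + 1) = n - i - 1 by omega, hT]
      push_cast
      ring
    · refine Finset.sum_congr rfl fun i hi => ?_
      have hi' := Finset.mem_range.1 hi
      rw [← Nat.choose_mul_succ_eq k i, show n - (k + 1 - i) = n - k + i - 1 by omega, hT]
      push_cast
      ring
  rw [div_mul_eq_mul_div, eq_div_iff hn, ← key]
  ring

/-! ### Pairs of walks and their distance -/

/-- The change of the horizontal distance between two walks caused by a pair of steps. -/
def stepDiff : LatticeStep → LatticeStep → ℤ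
  | .E, .N => 1
  | .N, .E => -1
  | _, _ => 0

/-- The number of East steps of the first walk minus that of the second. -/
def eastDiff (P Q : List LatticeStep) : ℤ :=
  P.count LatticeStep.E - Q.count LatticeStep.E

theorem eastDiff_cons (s t : LatticeStep) (P Q : List LatticeStep) :
    eastDiff (s :: P) (t :: Q) = stepDiff s t + eastDiff P Q := by
  cases s <;> cases t <;> simp [eastDiff, stepDiff] <;> ring

/-- The number of times `1, …, |P|` at which two walks meet, if the first one starts at horizontal
distance `d` from the second one on the same antidiagonal. -/
def meetTimes (d : ℤ) (P Q : List LatticeStep) : ℕ :=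
  ∑ i ∈ Finset.range P.length, if d + eastDiff (P.take (i + 1)) (Q.take (i + 1)) = 0 then 1 else 0

theorem meetTimes_cons (d : ℤ) (s t : LatticeStep) (P Q : List LatticeStep) :
    meetTimes d (s :: P) (t :: Q) =
      meetTimes (d + stepDiff s t) P Q + if d + stepDiff s t = 0 then 1 else 0 := by
  rw [meetTimes, List.length_cons, Finset.sum_range_succ']
  simp only [List.take_succ_cons, eastDiff_cons, meetTimes, ← add_assoc]
  simp [eastDiff]

instance : Fintype LatticeStep where
  elems := {.E, .N}
  complete s := by cases s <;> simp

/-- All pairs of words of length `m`. -/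
def wordPairs : ℕ → Finset (List LatticeStep × List LatticeStep)
  | 0 => {([], [])}
  | m + 1 => ((Finset.univ : Finset (LatticeStep × LatticeStep)) ×ˢ wordPairs m).image
      fun x => (x.1.1 :: x.2.1, x.1.2 :: x.2.2)

theorem sum_wordPairs_succ {M : Type*} [AddCommMonoid M] (m : ℕ)
    (F : List LatticeStep × List LatticeStep → M) :
    ∑ x ∈ wordPairs (m + 1), F x =
      ∑ s : LatticeStep × LatticeStep, ∑ x ∈ wordPairs m, F (s.1 :: x.1, s.2 :: x.2) := by
  rw [wordPairs, Finset.sum_image, Finset.sum_product]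
  rintro ⟨⟨a, b⟩, c, d⟩ - ⟨⟨a', b'⟩, c', d'⟩ -
  simp only [Prod.mk.injEq, List.cons.injEq]
  tauto

theorem mem_wordPairs {m : ℕ} {P Q : List LatticeStep} :
    (P, Q) ∈ wordPairs m ↔ P.length = m ∧ Q.length = m := by
  induction m generalizing P Q with
  | zero => simp [wordPairs]
  | succ m ih =>
    cases P <;> cases Q <;> simp [wordPairs, ih]

/-- The weight `y ^ #E * z ^ #N` of a walk. -/
noncomputable def walkWeight (P : List LatticeStep) : Series2 :=
  yVar ^ P.count LatticeStep.E * zVar ^ P.count LatticeStep.N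

/-- The generating polynomial of the pairs of walks of length `m` that start at horizontal distance
`d`, end at the same point and meet `j` times after the start. -/
noncomputable def meetPoly (m : ℕ) (d : ℤ) (j : ℕ) : Series2 :=
  ∑ x ∈ wordPairs m,
    if d + eastDiff x.1 x.2 = 0 ∧ meetTimes d x.1 x.2 = j then walkWeight x.1 else 0

/-- Given the family `F d j` for walks starting at distance `d` with `j` later meetings, the
contribution of those with `j` meetings when the start counts as well. -/
noncomputable def countStart (F : ℤ → ℕ → Series2) (d : ℤ) : ℕ → Series2
  | 0 => if d = 0 then 0 else F d 0
  | j + 1 => if d = 0 then F d j else F d (j + 1)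

theorem sum_countStart (m : ℕ) (d : ℤ) (j : ℕ) :
    (∑ x ∈ wordPairs m, if d + eastDiff x.1 x.2 = 0 ∧
        meetTimes d x.1 x.2 + (if d = 0 then 1 else 0) = j then walkWeight x.1 else 0) =
      countStart (meetPoly m) d j := by
  cases j <;> by_cases h : d = 0 <;> simp [countStart, meetPoly, h]

/-- Split by the first pair of steps. Only the first walk is weighted, since both walks end at the
same point. -/
theorem meetPoly_succ (m : ℕ) (d : ℤ) (j : ℕ) :
    meetPoly (m + 1) d j =
      yVar * countStart (meetPoly m) d j + zVar * countStart (meetPoly m) d j +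
        yVar * countStart (meetPoly m) (d + 1) j + zVar * countStart (meetPoly m) (d - 1) j := by
  have step : ∀ s t : LatticeStep,
      (∑ x ∈ wordPairs m, if d + eastDiff (s :: x.1) (t :: x.2) = 0 ∧
        meetTimes d (s :: x.1) (t :: x.2) = j then walkWeight (s :: x.1) else 0) =
      walkWeight [s] * countStart (meetPoly m) (d + stepDiff s t) j := by
    intro s t
    rw [← sum_countStart, Finset.mul_sum]
    refine Finset.sum_congr rfl fun x _ => ?_
    rw [eastDiff_cons, meetTimes_cons, ← add_assoc, mul_ite, mul_zero]
    congr 1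
    cases s <;> simp [walkWeight] <;> ring
  have hu : (Finset.univ : Finset LatticeStep) = {.E, .N} := rfl
  rw [meetPoly, sum_wordPairs_succ, Fintype.sum_prod_type, hu]
  simp only [Finset.sum_insert (show LatticeStep.E ∉ ({.N} : Finset LatticeStep) by simp),
    Finset.sum_singleton, step]
  simp [walkWeight, stepDiff, ← sub_eq_add_neg]
  ring

theorem meetPoly_zero (d : ℤ) (j : ℕ) : meetPoly 0 d j = if d = 0 ∧ j = 0 then 1 else 0 := by
  simp [meetPoly, wordPairs, eastDiff, meetTimes, walkWeight, eq_comm (a := 0)]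

/-- The closed form of the generating function of the pairs of walks that start at horizontal
distance `d`, end at the same point and meet `j` times after the start; `w = 1 + (y + z) w + yz w²`.
-/
noncomputable def meetSeries (w : Series2) (d : ℤ) : ℕ → Series2
  | 0 => if d = 0 then 1 else 0
  | j + 1 => (zVar * w) ^ d.toNat * (yVar * w) ^ (-d).toNat *
      (yVar + zVar + 2 * (yVar * zVar * w)) ^ (if d = 0 then j + 1 else j)

/-- First passage one level towards 0 has series zw or yw according to the sign of d. For d ≠ 0 the
recursion is a multiple of the quadratic for `w`; for d = 0 it reads off the factor y + z + 2yzw. -/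
theorem meetSeries_eq {w : Series2} (hw : w = 1 + (yVar + zVar) * w + yVar * zVar * w ^ 2)
    (d : ℤ) (j : ℕ) :
    meetSeries w d j = (if d = 0 ∧ j = 0 then 1 else 0) +
      (yVar * countStart (meetSeries w) d j + zVar * countStart (meetSeries w) d j +
        yVar * countStart (meetSeries w) (d + 1) j + zVar * countStart (meetSeries w) (d - 1) j) := by
  cases j with
  | zero =>
    have h0 : ∀ d, countStart (meetSeries w) d 0 = 0 := by
      intro d
      by_cases h : d = 0 <;> simp [countStart, meetSeries, h]
    simp [h0, meetSeries]
  | succ j =>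
    -- Counting the start lowers the exponent at d = 0 to j, so one formula covers d and both its
    -- neighbours.
    have hz : countStart (meetSeries w) 0 (j + 1) =
        (yVar + zVar + 2 * (yVar * zVar * w)) ^ j := by
      cases j <;> simp [countStart, meetSeries]
    have hpos : ∀ e : ℕ, countStart (meetSeries w) (e : ℤ) (j + 1) =
        (zVar * w) ^ e * (yVar + zVar + 2 * (yVar * zVar * w)) ^ j := by
      intro e
      cases e with
      | zero => simpa using hz
      | succ e =>
        have : ((e + 1 : ℕ) : ℤ) ≠ 0 := by omega
        have h2 : (-((e + 1 : ℕ) : ℤ)).toNat = 0 := by omega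
        simp only [countStart, if_neg this, meetSeries, h2, Int.toNat_natCast, pow_zero, mul_one]
    have hneg : ∀ e : ℕ, countStart (meetSeries w) (-(e : ℤ)) (j + 1) =
        (yVar * w) ^ e * (yVar + zVar + 2 * (yVar * zVar * w)) ^ j := by
      intro e
      cases e with
      | zero => simpa using hz
      | succ e =>
        have : -((e + 1 : ℕ) : ℤ) ≠ 0 := by omega
        have h2 : (-((e + 1 : ℕ) : ℤ)).toNat = 0 := by omega
        simp only [countStart, if_neg this, meetSeries, h2, neg_neg, Int.toNat_natCast, pow_zero,
          one_mul]
    have hs : ∀ d : ℤ, d ≠ 0 → meetSeries w d (j + 1) = countStart (meetSeries w) d (j + 1) := by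
      intro d hd
      simp [countStart, hd]
    simp only [Nat.add_eq_zero_iff, one_ne_zero, and_false, if_false, zero_add]
    obtain ⟨e, rfl | rfl⟩ := d.eq_nat_or_neg
    · cases e with
      | zero =>
        have h1 := hpos 1
        have h2 := hneg 1
        simp only [Nat.cast_one, pow_one] at h1 h2
        rw [Nat.cast_zero, zero_add, zero_sub, hz, h1, h2]
        simp [meetSeries]
        ring
      | succ e =>
        rw [hs _ (by omega), show ((e + 1 : ℕ) : ℤ) + 1 = ((e + 2 : ℕ) : ℤ) by push_cast; ring,
          show ((e + 1 : ℕ) : ℤ) - 1 = (e : ℤ) by push_cast; ring, hpos, hpos, hpos]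
        linear_combination
          (zVar * w) ^ e * zVar * (yVar + zVar + 2 * (yVar * zVar * w)) ^ j * hw
    · cases e with
      | zero =>
        have h1 := hpos 1
        have h2 := hneg 1
        simp only [Nat.cast_one, pow_one] at h1 h2
        rw [Nat.cast_zero, neg_zero, zero_add, zero_sub, hz, h1, h2]
        simp [meetSeries]
        ring
      | succ e =>
        rw [hs _ (by omega), show -((e + 1 : ℕ) : ℤ) + 1 = -(e : ℤ) by push_cast; ring,
          show -((e + 1 : ℕ) : ℤ) - 1 = -((e + 2 : ℕ) : ℤ) by push_cast; ring, hneg, hneg, hneg]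
        linear_combination
          (yVar * w) ^ e * yVar * (yVar + zVar + 2 * (yVar * zVar * w)) ^ j * hw

/-- Each term of the common recursion carries a factor y or z, so induction on the total degree
applies. -/
theorem coeffYZ_meetPoly {w : Series2} (hw : w = 1 + (yVar + zVar) * w + yVar * zVar * w ^ 2)
    (a b : ℕ) (d : ℤ) (j : ℕ) :
    coeffYZ a b (meetPoly (a + b) d j) = coeffYZ a b (meetSeries w d j) := by
  induction hm : a + b generalizing a b d j with
  | zero =>
    obtain ⟨rfl, rfl⟩ : a = 0 ∧ b = 0 := by omega
    rw [meetSeries_eq hw, meetPoly_zero]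
    simp [coeffYZ_add, coeffYZ_yVar_mul, coeffYZ_zVar_mul]
  | succ m ih =>
    have ih' : ∀ a b d, a + b = m → coeffYZ a b (countStart (meetPoly m) d j) =
        coeffYZ a b (countStart (meetSeries w) d j) := by
      intro a b d hab
      cases j <;> by_cases h : d = 0 <;> simp only [countStart, h, if_true, if_false] <;>
        exact ih _ _ _ _ hab
    have ihy : ∀ d, coeffYZ a b (yVar * countStart (meetPoly m) d j) =
        coeffYZ a b (yVar * countStart (meetSeries w) d j) := by
      intro d
      rw [coeffYZ_yVar_mul, coeffYZ_yVar_mul]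
      split_ifs with h
      · exact ih' _ _ _ (by omega)
      · rfl
    have ihz : ∀ d, coeffYZ a b (zVar * countStart (meetPoly m) d j) =
        coeffYZ a b (zVar * countStart (meetSeries w) d j) := by
      intro d
      rw [coeffYZ_zVar_mul, coeffYZ_zVar_mul]
      split_ifs with h
      · exact ih' _ _ _ (by omega)
      · rfl
    have h1 : coeffYZ a b (if d = 0 ∧ j = 0 then 1 else 0) = 0 := by
      split_ifs
      · rw [coeffYZ_one, if_neg (by omega)]
      · exact coeffYZ_zero a b
    rw [meetPoly_succ, meetSeries_eq hw]
    simp only [coeffYZ_add, ihy, ihz, h1, zero_add]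

/-! ### From meeting times to common vertices -/

theorem length_eq_count_add_count (P : List LatticeStep) :
    P.length = P.count LatticeStep.E + P.count LatticeStep.N :=
  latticeWalk_length (⟨P, rfl⟩ : LatticeWalk _ _)

theorem latticeEndpoint_eq_iff {P Q : List LatticeStep} (h : P.length = Q.length) :
    latticeEndpoint P = latticeEndpoint Q ↔ eastDiff P Q = 0 := by
  rw [length_eq_count_add_count P, length_eq_count_add_count Q] at h
  simp only [latticeEndpoint, Prod.mk.injEq, eastDiff]
  omega

/-- The coordinate sum of a vertex is the time of its visit, so common vertices are visited
simultaneously. The extra 1 is the terminal vertex. -/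
theorem numMeetings_add_one {a b : ℕ} (hab : 0 < a + b) (P Q : LatticeWalk a b) :
    numMeetings P Q + 1 = meetTimes 0 P.1 Q.1 := by
  have hP := latticeWalk_length P
  have hQ := latticeWalk_length Q
  obtain ⟨m, hm⟩ : ∃ m, a + b = m + 1 := ⟨a + b - 1, by omega⟩
  rw [hm] at hP hQ
  have hPf : P.1.take (m + 1) = P.1 := List.take_of_length_le hP.le
  have hQf : Q.1.take (m + 1) = Q.1 := List.take_of_length_le hQ.le
  have hend : eastDiff P.1 Q.1 = 0 :=
    (latticeEndpoint_eq_iff (hP.trans hQ.symm)).1 (P.2.trans Q.2.symm)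
  have hsum : ∀ (R : LatticeWalk a b) (i : ℕ), R.1.length = m + 1 → i ≤ m + 1 →
      (latticeEndpoint (R.1.take i)).1 + (latticeEndpoint (R.1.take i)).2 = i := by
    intro R i hR hi
    have := length_eq_count_add_count (R.1.take i)
    rw [List.length_take, hR, min_eq_left hi] at this
    exact this.symm
  have hset : (walkVertices P.1 ∩ walkVertices Q.1) \ {(0, 0), (a, b)} =
      ((Finset.range m).filter fun i =>
        eastDiff (P.1.take (i + 1)) (Q.1.take (i + 1)) = 0).image
          fun i => latticeEndpoint (P.1.take (i + 1)) := by
    ext v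
    simp only [walkVertices, hP, hQ, Finset.mem_sdiff, Finset.mem_inter, Finset.mem_image,
      Finset.mem_range, Finset.mem_insert, Finset.mem_singleton, Finset.mem_filter, not_or]
    constructor
    · rintro ⟨⟨⟨i, hi, rfl⟩, j, hj, hij⟩, h0, h1⟩
      have hi' := hsum P i hP (by omega)
      have hj' := hsum Q j hQ (by omega)
      obtain rfl : j = i := by rw [← hi', ← hj', hij]
      have hj0 : j ≠ 0 := by
        rintro rfl
        exact h0 (by simp [latticeEndpoint])
      have hj1 : j ≠ m + 1 := by
        rintro rfl
        exact h1 (by rw [hPf]; exact P.2)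
      obtain ⟨i, rfl⟩ := Nat.exists_eq_succ_of_ne_zero hj0
      refine ⟨i, ⟨by omega, ?_⟩, rfl⟩
      refine (latticeEndpoint_eq_iff ?_).1 hij.symm
      simp [hP, hQ]
    · rintro ⟨i, ⟨hi, hd⟩, rfl⟩
      have hs := hsum P (i + 1) hP (by omega)
      refine ⟨⟨⟨i + 1, by omega, rfl⟩, i + 1, by omega, ?_⟩, ?_, ?_⟩
      · refine ((latticeEndpoint_eq_iff ?_).2 hd).symm
        simp [hP, hQ]
      · intro h
        rw [h] at hs
        simp at hs
      · intro h
        rw [h] at hs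
        simp at hs
        omega
  rw [numMeetings, hset, Finset.card_image_of_injOn, Finset.card_filter, meetTimes, hP,
    Finset.sum_range_succ, hPf, hQf, hend]
  · simp
  · intro i hi j hj hij
    simp only [Finset.coe_filter, Finset.mem_range, Set.mem_ofPred_eq] at hi hj
    have hi' := hsum P (i + 1) hP (by omega)
    have hj' := hsum P (j + 1) hP (by omega)
    simp only at hij
    rw [hij] at hi'
    omega

/-- The monomial fixes the endpoint of the first walk; distance zero at the end fixes that of the
second. -/
theorem card_pairs_eq_coeffYZ_meetPoly {a b : ℕ} (hab : 0 < a + b) (k : ℕ) :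
    (Nat.card {PQ : LatticeWalk a b × LatticeWalk a b // numMeetings PQ.1 PQ.2 = k} : ℚ) =
      coeffYZ a b (meetPoly (a + b) 0 (k + 1)) := by
  classical
  have hcoeff : coeffYZ a b (meetPoly (a + b) 0 (k + 1)) =
      (((wordPairs (a + b)).filter fun x => latticeEndpoint x.1 = (a, b) ∧
        latticeEndpoint x.2 = (a, b) ∧ meetTimes 0 x.1 x.2 = k + 1).card : ℚ) := by
    rw [meetPoly, coeffYZ_sum, Finset.card_filter, Nat.cast_sum]
    refine Finset.sum_congr rfl fun x hx => ?_
    obtain ⟨h1, h2⟩ := mem_wordPairs.1 (show (x.1, x.2) ∈ wordPairs (a + b) from hx)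
    have key : (latticeEndpoint x.1 = (a, b) ∧ latticeEndpoint x.2 = (a, b)) ↔
        (eastDiff x.1 x.2 = 0 ∧ latticeEndpoint x.1 = (a, b)) := by
      rw [← latticeEndpoint_eq_iff (h1.trans h2.symm)]
      constructor
      · rintro ⟨p, q⟩
        exact ⟨p.trans q.symm, p⟩
      · rintro ⟨p, q⟩
        exact ⟨q, p.symm.trans q⟩
    simp only [← and_assoc, key, zero_add]
    rw [apply_ite (coeffYZ a b), coeffYZ_zero, walkWeight,
      coeffYZ_monomial, ← ite_and, Nat.cast_ite, Nat.cast_one, Nat.cast_zero]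
    refine if_congr ?_ rfl rfl
    simp only [latticeEndpoint, Prod.mk.injEq]
    tauto
  rw [hcoeff, Nat.cast_inj, ← Nat.subtype_card (p := fun x => latticeEndpoint x.1 = (a, b) ∧
    latticeEndpoint x.2 = (a, b) ∧ meetTimes 0 x.1 x.2 = k + 1)]
  · refine Nat.card_eq_of_bijective (fun x => ⟨(x.1.1.1, x.1.2.1), x.1.1.2, x.1.2.2, ?_⟩) ⟨?_, ?_⟩
    · rw [← numMeetings_add_one hab, x.2]
    · rintro ⟨⟨⟨P, hP⟩, Q, hQ⟩, h⟩ ⟨⟨⟨P', hP'⟩, Q', hQ'⟩, h'⟩ he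
      simpa using he
    · rintro ⟨⟨P, Q⟩, hP, hQ, h⟩
      refine ⟨⟨(⟨P, hP⟩, ⟨Q, hQ⟩), ?_⟩, rfl⟩
      have := numMeetings_add_one hab ⟨P, hP⟩ ⟨Q, hQ⟩
      simp only at this h ⊢
      omega
  · rintro ⟨P, Q⟩
    rw [Finset.mem_filter, mem_wordPairs]
    refine ⟨fun h => h.2, fun h => ⟨⟨?_, ?_⟩, h⟩⟩
    · exact latticeWalk_length ⟨P, h.1⟩
    · exact latticeWalk_length ⟨Q, h.2.1⟩

theorem pairCount_eq_coeffYZ {w : Series2}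
    (hw : w = 1 + (yVar + zVar) * w + yVar * zVar * w ^ 2) {n r : ℕ} (k : ℕ) (hn : 1 ≤ n)
    (hr : r ≤ n) :
    (pairCount n r k : ℚ) =
      coeffYZ r (n - r) ((yVar + zVar + 2 * (yVar * zVar * w)) ^ (k + 1)) := by
  rw [pairCount, card_pairs_eq_coeffYZ_meetPoly (by omega), coeffYZ_meetPoly hw]
  simp [meetSeries]

/-! ### The main theorem -/

theorem mainTheorem1 :
    ∃ s f : Series2,
      -- `s` is the square root of `(1 - y - z)² - 4yz`, and it is unique
      (IsFormalSqrt s ((1 - yVar - zVar) ^ 2 - 4 * yVar * zVar) ∧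
        ∀ s' : Series2,
          IsFormalSqrt s' ((1 - yVar - zVar) ^ 2 - 4 * yVar * zVar) → s' = s) ∧
      -- `f = ((1 - y - z) - √((1 - y - z)² - 4yz)) / 2`
      f = MvPowerSeries.C (1 / 2 : ℚ) * ((1 - yVar - zVar) - s) ∧
      -- `f` is the unique power series without constant term with `f = (y + f)(z + f)`
      (MvPowerSeries.constantCoeff f = 0 ∧ f = (yVar + f) * (zVar + f) ∧
        ∀ f' : Series2, MvPowerSeries.constantCoeff f' = 0 →
          f' = (yVar + f') * (zVar + f') → f' = f) ∧
      -- the generating function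
      (∀ n r k : ℕ, 1 ≤ n → r ≤ n →
        (pairCount n r k : ℚ) = coeffYZ r (n - r) ((yVar + zVar + 2 * f) ^ (k + 1))) ∧
      -- the explicit formula
      (∀ n r k : ℕ, r ≤ n → k + 2 ≤ n →
        (pairCount n r k : ℚ) =
          2 * ((k : ℚ) + 1) / ((n : ℚ) - (k : ℚ) - 1) *
            ∑ i ∈ Finset.range (k + 1),
              (Nat.choose k i : ℚ) * (Nat.choose (n - k + i - 1) r : ℚ) *
                (Nat.choose (n - i - 1) (n - r) : ℚ)) := by
  obtain ⟨w, hw⟩ := exists_narayana_series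
  have hy : MvPowerSeries.constantCoeff yVar = (0 : ℚ) := MvPowerSeries.constantCoeff_X _
  have hz : MvPowerSeries.constantCoeff zVar = (0 : ℚ) := MvPowerSeries.constantCoeff_X _
  have hC : (MvPowerSeries.C (1 / 2 : ℚ) : Series2) * 2 = 1 := by
    rw [← map_ofNat (MvPowerSeries.C : ℚ →+* Series2) 2, ← map_mul]
    norm_num
  refine ⟨1 - yVar - zVar - 2 * (yVar * zVar * w), yVar * zVar * w, ⟨⟨?_, ?_⟩, ?_⟩, ?_,
    ⟨?_, ?_, ?_⟩, ?_, ?_⟩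
  · linear_combination (-4 * yVar * zVar) * hw
  · simp [hy, hz]
  · rintro s ⟨hs, hs1⟩
    have hsq : s ^ 2 = (1 - yVar - zVar - 2 * (yVar * zVar * w)) ^ 2 := by
      rw [hs]
      linear_combination (4 * yVar * zVar) * hw
    rcases sq_eq_sq_iff_eq_or_eq_neg.1 hsq with h | h
    · exact h
    · have := congrArg MvPowerSeries.constantCoeff h
      simp [hs1, hy, hz] at this
      norm_num at this
  · linear_combination (-(yVar * zVar * w)) * hC
  · simp [hy]
  · linear_combination (yVar * zVar) * hw
  · intro f hf0 hf
    -- Two solutions of the quadratic differ by a zero divisor relation whose second factor has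
    -- constant term 1, hence is nonzero.
    have hprod : (f - yVar * zVar * w) * (1 - yVar - zVar - f - yVar * zVar * w) = 0 := by
      linear_combination hf - (yVar * zVar) * hw
    rcases mul_eq_zero.1 hprod with h | h
    · exact sub_eq_zero.1 h
    · have := congrArg MvPowerSeries.constantCoeff h
      simp [hf0, hy, hz] at this
  · intro n r k hn hr
    exact pairCount_eq_coeffYZ hw k hn hr
  · intro n r k hr hk
    have hαβ : (1 + zVar * w) * (1 + yVar * w) = w := by linear_combination -hw
    rw [pairCount_eq_coeffYZ hw k (by omega) hr,
      ← coeffYZ_add_pow (α := 1 + zVar * w) (β := 1 + yVar * w) (by rw [hαβ]) (by rw [hαβ]) hr hk]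
    congr 2
    ring
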